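/- Let $R$ be a commutative Noetherian ring of finite Krull dimension and let $M$ be a finitely generated $R$-module. For an $R$-module $N$ define its (ordinal) length $\ell(N)$ as the supremum of all ordinals $\alpha$ for which there is a strictly descending chain $(N_\beta)_{\beta\le\alpha}$ of submodules of $N$ (so a finite chain $N_0\supsetneq N_1\supsetneq\dots\supsetneq N_n$ has length $n$). Write $\alpha\oplus\beta$ for the shuffle (natural, Hessenberg) sum of ordinals, obtained by adding the coefficients of the Cantor normal forms $\alpha=a_d\omega^d+\dots+a_0$ and $\beta=b_d\omega^d+\dots+b_0$. If $M\neq 0$, the order of $M$ is the least $i$ for which the coefficient of $\omega^i$ in the Cantor normal form of $\ell(M)$ is nonzero (the order of $0$ is undefined). Then: 1. If $f$ is an endomorphism of $M$ such that the Krull dimension of $\ker(f)$ is equal to the order of $M$, then $f$ satisfies the rank-nullity equality $$\ell(M)=\ell(\ker f)\oplus \ell(f(M)).$$ 2. In particular, if $M$ is unmixed, that is, if $\dim(R/\mathfrak p)=\dim M$ for every associated prime $\mathfrak p$ of $M$, then every endomorphism $f$ of $M$ satisfies $\ell(M)=\ell(\ker f)\oplus\ell(f(M))$. -/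

import Mathlib

universe u v

namespace OrdLen

open Ordinal

/-- The ordinals `α` for which `M` has a strictly descending chain of submodules
`(N β)`, `β ≤ α`. A finite chain `N 0 ⊋ N 1 ⊋ ⋯ ⊋ N n` counts as a chain of length `n`. -/
def chainLengths (R : Type u) [CommRing R] (M : Type v) [AddCommGroup M] [Module R M] :
    Set Ordinal.{v} :=
  {α | ∃ N : Ordinal.{v} → Submodule R M, StrictAntiOn N (Set.Iic α)}

/-- The chain lengths are bounded, so that their supremum below is a genuine one. -/
theorem bddAbove_chainLengths (R : Type u) [CommRing R] (M : Type v) [AddCommGroup M]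
    [Module R M] : BddAbove (chainLengths R M) := by
  refine ⟨(Order.succ (Cardinal.mk (Submodule R M))).ord, ?_⟩
  rintro α ⟨N, hN⟩
  by_contra! h
  have hinj : Function.Injective
      (fun β : (Order.succ (Cardinal.mk (Submodule R M))).ord.ToType =>
        N (typein (α := (Order.succ (Cardinal.mk (Submodule R M))).ord.ToType) (· < ·) β)) := by
    intro a b hab
    have ha := (typein_lt_self a).le.trans h.le
    have hb := (typein_lt_self b).le.trans h.le
    exact (typein_injective _) (hN.injOn ha hb hab)
  have := Cardinal.mk_le_of_injective hinj
  rw [Cardinal.mk_toType, Cardinal.card_ord] at this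
  exact absurd this (not_le.2 (Order.lt_succ _))

/-- The (ordinal) length of a module: the supremum of the lengths of the strictly descending
chains of its submodules. -/
noncomputable def length (R : Type u) [CommRing R] (M : Type v) [AddCommGroup M] [Module R M] :
    Ordinal.{v} :=
  sSup (chainLengths R M)

/-- The shuffle (natural, Hessenberg) sum: the coefficients in the Cantor normal forms
(in base `ω`) are added. -/
noncomputable def shuffleSum (α β : Ordinal.{v}) : Ordinal.{v} :=
  CNF.eval ω (CNF.coeff ω α + CNF.coeff ω β)

/-- The support of an ordinal of finite degree: the exponents `i` for which `ω ^ i` has a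
nonzero coefficient in the Cantor normal form. -/
def support (α : Ordinal.{v}) : Set ℕ :=
  {i | CNF.coeff ω α (i : Ordinal.{v}) ≠ 0}

/-- `e` is the order of the module `M`: the least element of the support of its length.
(The zero module has no order.) -/
def IsOrder (R : Type u) [CommRing R] (M : Type v) [AddCommGroup M] [Module R M] (e : ℕ) : Prop :=
  IsLeast (support (length R M)) e

/-- A submodule is low if its Krull dimension is the order of the ambient module. -/
def IsLow {R : Type u} [CommRing R] {M : Type v} [AddCommGroup M] [Module R M]
    (N : Submodule R M) : Prop :=
  ∃ e : ℕ, IsOrder R M e ∧ Module.supportDim R N = (e : WithBot ℕ∞)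

/-- A module is unmixed if all its associated primes have the same dimension as the module. -/
def IsUnmixed (R : Type u) [CommRing R] (M : Type v) [AddCommGroup M] [Module R M] : Prop :=
  ∀ p ∈ associatedPrimes R M, ringKrullDim (R ⧸ p) = Module.supportDim R M

/-- The rank-nullity equality for an endomorphism. -/
def SatisfiesRankNullity {R : Type u} [CommRing R] {M : Type v} [AddCommGroup M] [Module R M]
    (f : Module.End R M) : Prop :=
  length R M = shuffleSum (length R (LinearMap.ker f)) (length R (LinearMap.range f))

end OrdLen

/-! For a short exact sequence `0 → N → M → Q → 0`, gluing chains gives ℓ(Q) + ℓ(N) ≤ ℓ(M), once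
lengths are known to be attained (`length_mem_chainLengths`). Recording how a chain of `M` drops in
`N` and in `Q` gives ℓ(M) ≤ ℓ(Q) ⊕ ℓ(N) (`length_le_of_exact`). If ℓ(N) < ω^(e+1) and ω^e divides
ℓ(Q), no exponent of ℓ(N) exceeds one of ℓ(Q), so the two sums agree and the bounds meet.

This is applied to N = ker f, Q = f(M). If dim ker f ≤ e then ℓ(ker f) < ω^(e+1)
(`length_lt_opow_of_supportDim_lt`). Moreover ω^e divides a length exactly when no nonzero submodule
is shorter than ω^e (`opow_dvd_length`, `eq_bot_of_length_lt`), a property that `f(M)` inherits from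
`M`. Part 1 takes for e the order of `M`. In the unmixed case nonzero submodules have full dimension
d, hence length at least ω^d, and e = d works. -/

namespace OrdLen

open Ordinal

/-! ### Chains of submodules and exact sequences -/

section Chains

variable {R : Type u} [CommRing R] {M N Q : Type v} [AddCommGroup M] [Module R M]
  [AddCommGroup N] [Module R N] [AddCommGroup Q] [Module R Q]

theorem le_length {α : Ordinal.{v}} (h : α ∈ chainLengths R M) : α ≤ length R M :=
  le_csSup (bddAbove_chainLengths R M) h

theorem zero_mem_chainLengths : (0 : Ordinal.{v}) ∈ chainLengths R M :=
  ⟨fun _ => ⊥, fun a ha b hb hab => by simp_all⟩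

theorem length_le {α : Ordinal.{v}} (h : ∀ β ∈ chainLengths R M, β ≤ α) : length R M ≤ α :=
  csSup_le ⟨0, zero_mem_chainLengths⟩ h

theorem chainLengths_subset_of_injective (f : N →ₗ[R] M) (hf : Function.Injective f) :
    chainLengths R N ⊆ chainLengths R M := by
  rintro α ⟨c, hc⟩
  exact ⟨fun β => (c β).map f,
    fun a ha b hb hab => Submodule.map_strictMono_of_injective hf (hc ha hb hab)⟩

theorem chainLengths_subset_of_surjective (g : M →ₗ[R] Q) (hg : Function.Surjective g) :
    chainLengths R Q ⊆ chainLengths R M := by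
  rintro α ⟨c, hc⟩
  exact ⟨fun β => (c β).comap g,
    fun a ha b hb hab => Submodule.comap_strictMono_of_surjective hg (hc ha hb hab)⟩

theorem length_le_of_injective (f : N →ₗ[R] M) (hf : Function.Injective f) :
    length R N ≤ length R M :=
  length_le fun _ h => le_length (chainLengths_subset_of_injective f hf h)

theorem length_le_of_surjective (g : M →ₗ[R] Q) (hg : Function.Surjective g) :
    length R Q ≤ length R M :=
  length_le fun _ h => le_length (chainLengths_subset_of_surjective g hg h)

theorem length_eq_of_equiv (e : M ≃ₗ[R] N) : length R M = length R N :=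
  (length_le_of_injective e.toLinearMap e.injective).antisymm
    (length_le_of_surjective e.toLinearMap e.surjective)

theorem length_eq_zero_of_subsingleton [Subsingleton M] : length R M = 0 := by
  refine le_antisymm (length_le ?_) zero_le
  rintro α ⟨c, hc⟩
  by_contra! h
  exact (hc (zero_le : (0:Ordinal) ≤ α) (le_refl α) h).ne (Subsingleton.elim _ _)

theorem one_mem_chainLengths [Nontrivial M] : (1 : Ordinal.{v}) ∈ chainLengths R M := by
  refine ⟨fun β => if β = 0 then ⊤ else ⊥, fun a ha b hb hab => ?_⟩
  have hb0 : b ≠ 0 := (pos_of_gt hab).ne'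
  have ha0 : a = 0 := by
    rw [← Order.lt_one_iff]
    exact hab.trans_le hb
  simp [hb0, ha0, bot_lt_top]

theorem subsingleton_of_length_lt_one (h : length R M < 1) : Subsingleton M := by
  by_contra hM
  rw [not_subsingleton_iff_nontrivial] at hM
  exact h.not_ge (le_length one_mem_chainLengths)

theorem add_mem_chainLengths {f : N →ₗ[R] M} {g : M →ₗ[R] Q} (hf : Function.Injective f)
    (hg : Function.Surjective g) (h : Function.Exact f g) {α β : Ordinal.{v}}
    (hα : α ∈ chainLengths R Q) (hβ : β ∈ chainLengths R N) : α + β ∈ chainLengths R M := by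
  obtain ⟨c, hc⟩ := hα
  obtain ⟨d, hd⟩ := hβ
  have hker : LinearMap.ker g = (⊤ : Submodule R N).map f := by
    rw [h.linearMap_ker_eq, Submodule.map_top]
  refine ⟨fun γ => if γ ≤ α then (c γ).comap g else (d (γ - α)).map f, fun a ha b hb hab => ?_⟩
  by_cases hbα : b ≤ α
  · simp only [hbα, hab.le.trans hbα, if_true]
    exact Submodule.comap_strictMono_of_surjective hg (hc (hab.le.trans hbα) hbα hab)
  have hb' : b - α ≤ β := by rw [Ordinal.sub_le]; exact hb
  have hb0 : 0 < b - α := Ordinal.lt_sub.2 (by simpa using hbα)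
  by_cases haα : a ≤ α
  · simp only [hbα, haα, if_true, if_false]
    refine (Submodule.map_strictMono_of_injective hf
      ((hd (zero_le : (0:Ordinal) ≤ β) hb' hb0).trans_le le_top)).trans_le ?_
    rw [← hker]
    exact Submodule.comap_mono bot_le
  · simp only [hbα, haα, if_false]
    have : a - α < b - α := by
      rw [Ordinal.lt_sub, Ordinal.add_sub_cancel_of_le (not_le.1 haα).le]
      exact hab
    exact Submodule.map_strictMono_of_injective hf (hd (this.le.trans hb') hb' this)

theorem mem_chainLengths_quotient {c : Ordinal.{v} → Submodule R M} {α : Ordinal.{v}}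
    (hc : StrictAntiOn c (Set.Iic α)) : α ∈ chainLengths R (M ⧸ c α) := by
  refine ⟨fun β => (c β).map (c α).mkQ, fun a ha b hb hab => ?_⟩
  have key : ∀ β ≤ α, ((c β).map (c α).mkQ).comap (c α).mkQ = c β := fun β hβ => by
    rw [Submodule.comap_map_mkQ, sup_eq_right]
    exact hc.antitoneOn hβ (le_refl α) hβ
  refine lt_of_le_not_ge (Submodule.map_mono (hc ha hb hab).le) fun hle => ?_
  have := Submodule.comap_mono (f := (c α).mkQ) hle
  rw [key a ha, key b hb] at this
  exact (hc ha hb hab).not_ge this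

theorem mem_chainLengths_of_forall_le {c : Ordinal.{v} → Submodule R M} {α : Ordinal.{v}}
    (hc : StrictAntiOn c (Set.Iic α)) {D : Submodule R M} (hD : ∀ β ≤ α, c β ≤ D) :
    α ∈ chainLengths R D := by
  refine ⟨fun β => (c β).submoduleOf D, fun a ha b hb hab => ?_⟩
  refine lt_of_le_not_ge (Submodule.comap_mono (hc ha hb hab).le) fun hle => ?_
  have := Submodule.map_mono (f := D.subtype) hle
  simp only [Submodule.submoduleOf, Submodule.map_comap_subtype, inf_eq_right.2 (hD a ha),
    inf_eq_right.2 (hD b hb)] at this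
  exact (hc ha hb hab).not_ge this

theorem strictAntiOn_add {c : Ordinal.{v} → Submodule R M} {α β : Ordinal.{v}}
    (hc : StrictAntiOn c (Set.Iic (α + β))) :
    StrictAntiOn (fun γ => c (α + γ)) (Set.Iic β) := fun a ha b hb hab =>
  hc (add_le_add_right (Set.mem_Iic.1 ha) α : α + a ≤ α + β)
    (add_le_add_right (Set.mem_Iic.1 hb) α : α + b ≤ α + β) (add_lt_add_right hab α)

/-- The ordinals at which a weakly descending family of submodules drops are counted by a chain. -/
theorem exists_rank_of_antitoneOn {A : Ordinal.{v} → Submodule R M} {α : Ordinal.{v}}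
    (hA : AntitoneOn A (Set.Iic α)) :
    ∃ a : Ordinal.{v} → Ordinal.{v}, (∀ β γ, β ≤ γ → γ ≤ α → a β ≤ a γ) ∧
      (∀ β γ, β ≤ γ → γ ≤ α → A β ≠ A γ → a β < a γ) ∧ ∀ β ≤ α, a β ∈ chainLengths R M := by
  let t : Ordinal.{v} → Ordinal.{v} := fun β => sInf {δ | A δ = A β}
  have hAt : ∀ β, A (t β) = A β := fun β => csInf_mem (s := {δ | A δ = A β}) ⟨β, rfl⟩
  have ht : ∀ β, t β ≤ β := fun β => csInf_le' rfl
  have htmono : ∀ β γ, β ≤ γ → γ ≤ α → t β ≤ t γ := fun β γ h hγ => by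
    by_contra! hlt
    have h1 : A (t γ) ≤ A β := by
      rw [hAt]
      exact hA (h.trans hγ) hγ h
    have h2 : A β ≤ A (t γ) := by
      rw [← hAt β]
      exact hA (((ht γ).trans hγ)) ((ht β).trans (h.trans hγ)) hlt.le
    exact hlt.not_ge (csInf_le' (h1.antisymm h2))
  -- Fixed points of `t` are the indices where a new value of `A` appears; the ordinals above `α`
  -- only make `T` unbounded, as `enumOrd` needs.
  let T : Set Ordinal.{v} := {δ | t δ = δ ∨ α < δ}
  have hT : ¬ BddAbove T := by
    rw [not_bddAbove_iff]
    intro x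
    exact ⟨Order.succ (max x α), Or.inr (Order.lt_succ_of_le (le_max_right _ _)),
      Order.lt_succ_of_le (le_max_left _ _)⟩
  have htT : ∀ β, t β ∈ T := fun β => Or.inl (by simp only [t]; rw [hAt])
  choose a ha using fun β => enumOrd_surjective hT (htT β)
  refine ⟨a, fun β γ h hγ => ?_, fun β γ h hγ hne => ?_, fun β hβ => ?_⟩
  · rw [← enumOrd_le_enumOrd hT, ha, ha]
    exact htmono β γ h hγ
  · rw [← enumOrd_lt_enumOrd hT, ha, ha]
    refine (htmono β γ h hγ).lt_of_ne fun heq => hne ?_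
    rw [← hAt β, heq, hAt]
  · refine ⟨fun δ => A (enumOrd T δ), fun x hx y hy hxy => ?_⟩
    have hle : ∀ z ≤ a β, enumOrd T z ≤ α := fun z hz =>
      ((enumOrd_le_enumOrd hT).2 hz).trans (by rw [ha]; exact (ht β).trans hβ)
    have hlt := (enumOrd_lt_enumOrd hT).2 hxy
    refine (hA (hle x hx) (hle y hy) hlt.le).lt_of_ne fun heq => ?_
    rcases enumOrd_mem hT y with h | h
    · refine hlt.not_ge ?_
      rw [← h]
      exact csInf_le' heq.symm
    · exact h.not_ge (hle y hy)

/-- At each strict step of a chain in `M`, the image in `Q` or the trace on `N` must drop. Combining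
the two drop counts by a strictly monotone `G` gives a strictly increasing function of the index,
which is at least the index. -/
theorem length_le_of_exact {f : N →ₗ[R] M} {g : M →ₗ[R] Q}
    (h : Function.Exact f g) {G : Ordinal.{v} → Ordinal.{v} → Ordinal.{v}}
    (hl : ∀ a a' b, a < a' → b ≤ length R N → G a b < G a' b)
    (hr : ∀ a b b', b < b' → b' ≤ length R N → G a b < G a b') :
    length R M ≤ G (length R Q) (length R N) := by
  have hl' : ∀ a a' b, a ≤ a' → b ≤ length R N → G a b ≤ G a' b := fun a a' b h hb => by
    rcases h.eq_or_lt with rfl | h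
    exacts [le_rfl, (hl a a' b h hb).le]
  have hr' : ∀ a b b', b ≤ b' → b' ≤ length R N → G a b ≤ G a b' := fun a b b' h hb => by
    rcases h.eq_or_lt with rfl | h
    exacts [le_rfl, (hr a b b' h hb).le]
  refine length_le ?_
  rintro α ⟨c, hc⟩
  obtain ⟨a, ha1, ha2, ha3⟩ := exists_rank_of_antitoneOn (A := fun β => (c β).map g) (α := α)
    fun x hx y hy hxy => Submodule.map_mono (hc.antitoneOn hx hy hxy)
  obtain ⟨b, hb1, hb2, hb3⟩ := exists_rank_of_antitoneOn (A := fun β => (c β).comap f) (α := α)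
    fun x hx y hy hxy => Submodule.comap_mono (hc.antitoneOn hx hy hxy)
  have hstep : ∀ β γ, β < γ → γ ≤ α → G (a β) (b β) < G (a γ) (b γ) := fun β γ hβγ hγ => by
    have hbγ := le_length (hb3 γ hγ)
    have hab := ha1 β γ hβγ.le hγ
    have hbb := hb1 β γ hβγ.le hγ
    by_cases h1 : (c β).map g = (c γ).map g
    · refine (hl' _ _ _ hab (hbb.trans hbγ)).trans_lt (hr _ _ _ (hb2 β γ hβγ.le hγ ?_) hbγ)
      intro h2
      have hlt := hc (hβγ.le.trans hγ) hγ hβγ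
      refine hlt.not_ge fun x hx => ?_
      obtain ⟨y, hy, hxy⟩ : g x ∈ (c γ).map g := h1 ▸ Submodule.mem_map_of_mem hx
      obtain ⟨n, hn⟩ := (h (x - y)).1 (by rw [map_sub, hxy, _root_.sub_self])
      have : n ∈ (c γ).comap f := by
        rw [← h2, Submodule.mem_comap, hn]
        exact sub_mem hx (hlt.le hy)
      rw [Submodule.mem_comap, hn] at this
      simpa using add_mem this hy
    · exact (hl _ _ _ (ha2 β γ hβγ.le hγ h1) (hbb.trans hbγ)).trans_le (hr' _ _ _ hbb hbγ)
  have hle : ∀ β ≤ α, β ≤ G (a β) (b β) := fun β => by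
    induction β using WellFoundedLT.induction with
    | ind β ih =>
      intro hβ
      by_contra! hlt
      exact ((ih _ hlt (hlt.le.trans hβ)).trans_lt (hstep _ _ hlt hβ)).false
  exact (hle α le_rfl).trans ((hl' _ _ _ (le_length (ha3 α le_rfl)) (le_length (hb3 α le_rfl))).trans
    (hr' _ _ _ (le_length (hb3 α le_rfl)) le_rfl))

/-- A chain in the cokernel of an injective endomorphism can be repeated infinitely often. -/
theorem mul_omega0_mem_chainLengths [Nontrivial M] {φ : M →ₗ[R] M} (hφ : Function.Injective φ)
    {α : Ordinal.{v}} (hα0 : 0 < α) (hα : α ∈ chainLengths R (M ⧸ LinearMap.range φ)) :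
    α * ω ∈ chainLengths R M := by
  obtain ⟨c, hc⟩ := hα
  let d : Ordinal.{v} → Submodule R M := fun β => (c β).comap (LinearMap.range φ).mkQ
  have hd : StrictAntiOn d (Set.Iic α) := fun a ha b hb hab =>
    Submodule.comap_strictMono_of_surjective (Submodule.mkQ_surjective _) (hc ha hb hab)
  have hdφ : ∀ β, (⊤ : Submodule R M).map φ ≤ d β := fun β => by
    rw [Submodule.map_top]
    exact (LinearMap.range φ).le_comap_mkQ _
  have hpow : ∀ k : ℕ, Function.Injective (φ ^ k) := fun k => by
    rw [Module.End.coe_pow]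
    exact hφ.iterate k
  have hsucc : ∀ k : ℕ, (⊤ : Submodule R M).map (φ ^ (k + 1)) =
      ((⊤ : Submodule R M).map φ).map (φ ^ k) := fun k => by
    rw [← Submodule.map_comp, pow_succ]
    rfl
  have hanti : Antitone fun k : ℕ => (⊤ : Submodule R M).map (φ ^ k) :=
    antitone_nat_of_succ_le fun k => by
      rw [hsucc]
      exact Submodule.map_mono le_top
  let E : ℕ → Ordinal.{v} → Submodule R M := fun k r => (d r).map (φ ^ k)
  have hE : ∀ k k' r r', k < k' → r < α → E k' r' < E k r := fun k k' r r' hk hr =>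
    calc E k' r' ≤ (⊤ : Submodule R M).map (φ ^ k') := Submodule.map_mono le_top
      _ ≤ (⊤ : Submodule R M).map (φ ^ (k + 1)) := hanti hk
      _ ≤ E k α := by rw [hsucc]; exact Submodule.map_mono (hdφ α)
      _ < E k r := Submodule.map_strictMono_of_injective (hpow k) (hd hr.le (le_refl α) hr)
  have hdiv : ∀ β < α * ω, ∃ k : ℕ, β / α = k := fun β hβ =>
    lt_omega0.1 ((Ordinal.lt_mul_iff_div_lt hα0.ne').1 hβ)
  choose! κ hκ using hdiv
  -- For β = α * k + r with r < α, the k-th block is the original chain pushed forward by `φ ^ k`.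
  refine ⟨fun β => if β < α * ω then E (κ β) (β % α) else ⊥, fun x hx y hy hxy => ?_⟩
  have hx' : x < α * ω := hxy.trans_le hy
  have hxr := Ordinal.mod_lt x hα0.ne'
  by_cases hy' : y < α * ω
  · simp only [hx', hy', if_true]
    have hyr := Ordinal.mod_lt y hα0.ne'
    have hle : κ x ≤ κ y := by
      have := Ordinal.div_le_left hxy.le α
      rw [hκ x hx', hκ y hy'] at this
      exact_mod_cast this
    rcases hle.eq_or_lt with heq | hlt
    · rw [← heq]
      refine Submodule.map_strictMono_of_injective (hpow _) (hd hxr.le hyr.le ?_)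
      have h1 := Ordinal.div_add_mod x α
      have h2 := Ordinal.div_add_mod y α
      rw [hκ x hx'] at h1
      rw [hκ y hy', ← heq] at h2
      rw [← h1, ← h2] at hxy
      exact lt_of_add_lt_add_left hxy
    · exact hE _ _ _ _ hlt hxr
  · simp only [hx', hy', if_true, if_false]
    exact bot_le.trans_lt (hE (κ x) (κ x + 1) (x % α) 0 (Nat.lt_succ_self _) hxr)

end Chains

/-! ### Natural sums and Cantor normal forms -/

section Arithmetic

/-- The natural sum of ordinals, as far as terms of degree at most `e` in the second one are
concerned. -/
noncomputable def truncNatAdd : ℕ → Ordinal.{v} → Ordinal.{v} → Ordinal.{v}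
  | 0, a, b => a + b
  | e + 1, a, b => ω ^ ((e + 1 : ℕ) : Ordinal.{v}) *
      (a / ω ^ ((e + 1 : ℕ) : Ordinal.{v}) + b / ω ^ ((e + 1 : ℕ) : Ordinal.{v})) +
      truncNatAdd e (a % ω ^ ((e + 1 : ℕ) : Ordinal.{v})) (b % ω ^ ((e + 1 : ℕ) : Ordinal.{v}))

theorem omega0_opow_natCast_succ (e : ℕ) :
    (ω : Ordinal.{v}) ^ ((e + 1 : ℕ) : Ordinal.{v}) = ω ^ (e : Ordinal.{v}) * ω := by
  rw [Nat.cast_succ, opow_add, opow_one]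

theorem omega0_opow_pos (e : Ordinal.{v}) : 0 < (ω : Ordinal.{v}) ^ e :=
  opow_pos _ omega0_pos

theorem mul_add_lt_mul_add {c q q' r r' : Ordinal.{v}} (hr : r < c) (hq : q < q') :
    c * q + r < c * q' + r' :=
  calc c * q + r < c * q + c := add_lt_add_right hr _
    _ = c * (q + 1) := by rw [mul_add, mul_one]
    _ ≤ c * q' := mul_le_mul_right (Order.add_one_le_of_lt hq) c
    _ ≤ c * q' + r' := le_self_add

theorem add_lt_add_of_lt_omega0 {a a' b : Ordinal.{v}} (h : a < a') (hb : b < ω) :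
    a + b < a' + b := by
  obtain ⟨n, rfl⟩ := lt_omega0.1 hb
  by_contra! hle
  exact h.not_ge ((Ordinal.add_le_add_iff_right n).1 hle)

theorem truncNatAdd_lt {e : ℕ} {a b : Ordinal.{v}} (ha : a < ω ^ ((e + 1 : ℕ) : Ordinal.{v}))
    (hb : b < ω ^ ((e + 1 : ℕ) : Ordinal.{v})) :
    truncNatAdd e a b < ω ^ ((e + 1 : ℕ) : Ordinal.{v}) := by
  induction e generalizing a b with
  | zero =>
    simp only [zero_add, Nat.cast_one, opow_one, truncNatAdd] at *
    exact isPrincipal_add_omega0 ha hb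
  | succ e ih =>
    have hc := (omega0_opow_pos ((e + 1 : ℕ) : Ordinal.{v})).ne'
    rw [omega0_opow_natCast_succ (e + 1)] at *
    have h1 := (lt_mul_iff_div_lt hc).1 ha
    have h2 := (lt_mul_iff_div_lt hc).1 hb
    have h3 := isPrincipal_add_omega0 h1 h2
    have h4 := mul_add_lt_mul_add (r' := 0) (ih (mod_lt a hc) (mod_lt b hc)) h3
    simpa [truncNatAdd] using h4

/-- The bound on `b` makes each of its digits finite, and right addition of a finite ordinal is
strictly monotone, unlike that of ω. -/
theorem truncNatAdd_strictMono_left {e : ℕ} {a a' b : Ordinal.{v}} (h : a < a')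
    (hb : b < ω ^ ((e + 1 : ℕ) : Ordinal.{v})) : truncNatAdd e a b < truncNatAdd e a' b := by
  induction e generalizing a a' b with
  | zero =>
    simp only [zero_add, Nat.cast_one, opow_one, truncNatAdd] at *
    exact add_lt_add_of_lt_omega0 h hb
  | succ e ih =>
    have hc := (omega0_opow_pos ((e + 1 : ℕ) : Ordinal.{v})).ne'
    rw [omega0_opow_natCast_succ (e + 1)] at hb
    simp only [truncNatAdd]
    rcases (div_le_left h.le (ω ^ ((e + 1 : ℕ) : Ordinal.{v}))).eq_or_lt with hq | hq
    · rw [hq]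
      refine add_lt_add_right (ih ?_ (mod_lt _ hc)) _
      rw [← div_add_mod a (ω ^ ((e + 1 : ℕ) : Ordinal.{v})),
        ← div_add_mod a' (ω ^ ((e + 1 : ℕ) : Ordinal.{v})), hq] at h
      exact lt_of_add_lt_add_left h
    · exact mul_add_lt_mul_add (truncNatAdd_lt (mod_lt _ hc) (mod_lt _ hc))
        (add_lt_add_of_lt_omega0 hq ((lt_mul_iff_div_lt hc).1 hb))

theorem truncNatAdd_strictMono_right {e : ℕ} {a b b' : Ordinal.{v}} (h : b < b') :
    truncNatAdd e a b < truncNatAdd e a b' := by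
  induction e generalizing a b b' with
  | zero => exact add_lt_add_right h _
  | succ e ih =>
    have hc := (omega0_opow_pos ((e + 1 : ℕ) : Ordinal.{v})).ne'
    simp only [truncNatAdd]
    rcases (div_le_left h.le (ω ^ ((e + 1 : ℕ) : Ordinal.{v}))).eq_or_lt with hq | hq
    · rw [hq]
      refine add_lt_add_right (ih ?_) _
      rw [← div_add_mod b (ω ^ ((e + 1 : ℕ) : Ordinal.{v})),
        ← div_add_mod b' (ω ^ ((e + 1 : ℕ) : Ordinal.{v})), hq] at h
      exact lt_of_add_lt_add_left h
    · exact mul_add_lt_mul_add (truncNatAdd_lt (mod_lt _ hc) (mod_lt _ hc))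
        (add_lt_add_right hq _)

theorem truncNatAdd_mul {e : ℕ} {γ b : Ordinal.{v}} (hb : b < ω ^ ((e + 1 : ℕ) : Ordinal.{v})) :
    truncNatAdd e (ω ^ (e : Ordinal.{v}) * γ) b = ω ^ (e : Ordinal.{v}) * γ + b := by
  induction e generalizing γ b with
  | zero => simp [truncNatAdd]
  | succ e ih =>
    have hc := (omega0_opow_pos ((e + 1 : ℕ) : Ordinal.{v})).ne'
    have h0 := ih (γ := 0) (mod_lt b hc)
    simp only [mul_zero, zero_add] at h0
    simp only [truncNatAdd]
    rw [mul_div_cancel _ hc, mul_mod, h0, mul_add, add_assoc, div_add_mod]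

theorem exists_eq_mul_add_opow {α : Ordinal.{v}} (h0 : α ≠ 0) {n : ℕ}
    (hn : α < ω ^ (n : Ordinal.{v})) :
    ∃ (i : ℕ) (δ : Ordinal.{v}), α = δ + ω ^ (i : Ordinal.{v}) := by
  classical
  have hex : ∃ i : ℕ, ¬ (ω : Ordinal.{v}) ^ ((i + 1 : ℕ) : Ordinal.{v}) ∣ α := by
    refine ⟨n, fun hd => ?_⟩
    refine (le_of_dvd h0 hd).not_gt (hn.trans ?_)
    rw [opow_lt_opow_iff_right one_lt_omega0]
    exact_mod_cast Nat.lt_succ_self n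
  have hdvd : (ω : Ordinal.{v}) ^ ((Nat.find hex : ℕ) : Ordinal.{v}) ∣ α := by
    rcases hi : Nat.find hex with _ | i
    · simp
    · exact not_not.1 (Nat.find_min hex (m := i) (by omega))
  obtain ⟨γ, hγ⟩ := hdvd
  have hω : ¬ ω ∣ γ := fun hd => by
    refine Nat.find_spec hex ?_
    obtain ⟨c, hc⟩ := hd
    exact ⟨c, by rw [omega0_opow_natCast_succ, mul_assoc, ← hc]; exact hγ⟩
  -- By maximality of the exponent, `γ` is not a multiple of ω, hence is a successor; its last unit
  -- contributes the final power of ω.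
  rw [← isSuccPrelimit_iff_omega0_dvd] at hω
  obtain ⟨δ, rfl⟩ := Order.mem_range_succ_of_not_isSuccPrelimit hω
  exact ⟨_, _, by rwa [Order.succ_eq_add_one, mul_add, mul_one] at hγ⟩

theorem opow_dvd_eval {e : Ordinal.{v}} (f : Ordinal.{v} →₀ Ordinal.{v})
    (hf : ∀ i ∈ f.support, e ≤ i) : ω ^ e ∣ CNF.eval ω f := by
  induction f using Finsupp.induction_on_max with
  | zero => simp
  | single_add i x f hi hx ih =>
    rw [CNF.eval_single_add' _ hi]
    have hif : i ∉ f.support := fun h => (hi i h).false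
    have hsupp := Finsupp.support_single_add hif hx
    refine dvd_add ((opow_dvd_opow _ (hf i ?_)).mul_right x) (ih fun j hj => hf j ?_)
    · simp [hsupp]
    · rw [hsupp]
      exact Finset.mem_cons_of_mem hj

theorem coeff_lt_omega0 (α i : Ordinal.{v}) : CNF.coeff ω α i < ω := by
  by_cases h : i ∈ (CNF ω α).map Prod.fst
  · rw [List.mem_map] at h
    obtain ⟨⟨j, c⟩, hc, rfl⟩ := h
    rw [CNF.coeff_of_mem_CNF hc]
    exact CNF.snd_lt one_lt_omega0 hc
  · rw [CNF.coeff_of_notMem_CNF h]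
    exact omega0_pos

theorem opow_dvd_iff_coeff {e α : Ordinal.{v}} :
    ω ^ e ∣ α ↔ ∀ i < e, CNF.coeff ω α i = 0 := by
  constructor
  · intro h
    classical
    let f := CNF.coeff ω α
    -- The part of `α` with exponents below `e` is less than ω^e and divisible by it, so it
    -- vanishes.
    let f₁ := f.filter (fun i => e ≤ i)
    let f₂ := f.filter (fun i => i < e)
    have hb : ∀ i, f₂ i < ω := fun i => by
      simp only [f₂, Finsupp.filter_apply]
      split_ifs
      exacts [coeff_lt_omega0 α i, omega0_pos]
    have hsum : f₁ + f₂ = f := by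
      ext i
      rcases le_or_gt e i with h | h
      · simp [f₁, f₂, h, h.not_gt]
      · simp [f₁, f₂, h, h.not_ge]
    have hs₁ : ∀ i ∈ f₁.support, e ≤ i := fun i hi => by
      simp only [f₁, Finsupp.support_filter, Finset.mem_filter] at hi
      exact hi.2
    have hs₂ : ∀ i ∈ f₂.support, i < e := fun i hi => by
      simp only [f₂, Finsupp.support_filter, Finset.mem_filter] at hi
      exact hi.2
    have heval : α = CNF.eval ω f₁ + CNF.eval ω f₂ := by
      rw [← CNF.eval_add ω fun i hi j hj => (hs₂ j hj).le.trans (hs₁ i hi), hsum, CNF.eval_coeff]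
    rw [heval, dvd_add_iff (opow_dvd_eval f₁ hs₁)] at h
    have h0 : CNF.eval ω f₂ = 0 := by
      by_contra h0
      exact (le_of_dvd h0 h).not_gt (CNF.eval_lt hb hs₂)
    have hf₂ : f₂ = 0 := by
      rw [← CNF.coeff_eval one_lt_omega0 hb, h0, CNF.coeff_zero_right]
    intro i hi
    have := DFunLike.congr_fun hf₂ i
    simpa [f₂, hi] using this
  · intro h
    rw [← CNF.eval_coeff ω α]
    refine opow_dvd_eval _ fun i hi => ?_
    by_contra! hlt
    exact Finsupp.mem_support_iff.1 hi (h i hlt)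

/-- Every exponent of `β` is at least `e` and every exponent of `α` at most `e`, so nothing is
absorbed in `β + α`. -/
theorem shuffleSum_eq_add {e : ℕ} {α β : Ordinal.{v}} (hα : α < ω ^ ((e + 1 : ℕ) : Ordinal.{v}))
    (hβ : ω ^ (e : Ordinal.{v}) ∣ β) : shuffleSum α β = β + α := by
  have hcomm : CNF.coeff ω α + CNF.coeff ω β = CNF.coeff ω β + CNF.coeff ω α := by
    ext i
    obtain ⟨m, hm⟩ := lt_omega0.1 (coeff_lt_omega0 α i)
    obtain ⟨n, hn⟩ := lt_omega0.1 (coeff_lt_omega0 β i)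
    rw [Finsupp.add_apply, Finsupp.add_apply, hm, hn]
    exact_mod_cast Nat.add_comm m n
  rw [shuffleSum, hcomm, CNF.eval_add, CNF.eval_coeff, CNF.eval_coeff]
  intro i hi j hj
  rw [Finsupp.mem_support_iff] at hi hj
  have h1 : (e : Ordinal.{v}) ≤ i := by
    by_contra! h
    exact hi (opow_dvd_iff_coeff.1 hβ i h)
  refine le_trans ?_ h1
  by_contra! h
  refine hj (CNF.coeff_eq_zero_of_lt (hα.trans_le (opow_le_opow_right omega0_pos ?_)))
  rw [Nat.cast_succ]
  exact Order.add_one_le_of_lt h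

theorem IsOrder.opow_dvd_length {R : Type u} [CommRing R] {M : Type v} [AddCommGroup M]
    [Module R M] {e : ℕ} (h : IsOrder R M e) : ω ^ (e : Ordinal.{v}) ∣ length R M := by
  rw [opow_dvd_iff_coeff]
  intro i hi
  obtain ⟨n, rfl⟩ := lt_omega0.1 (hi.trans (natCast_lt_omega0 e))
  by_contra hn
  exact (h.2 hn).not_gt (by exact_mod_cast hi)

end Arithmetic

/-! ### Length versus Krull dimension -/

section Dimension

open scoped Pointwise

variable {R : Type u} [CommRing R] {M N Q : Type v} [AddCommGroup M] [Module R M]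
  [AddCommGroup N] [Module R N] [AddCommGroup Q] [Module R Q]

theorem length_lt_opow_of_exact {f : N →ₗ[R] M} {g : M →ₗ[R] Q}
    (h : Function.Exact f g) {i : ℕ} (hN : length R N < ω ^ (i : Ordinal.{v}))
    (hQ : length R Q < ω ^ (i : Ordinal.{v})) : length R M < ω ^ (i : Ordinal.{v}) := by
  cases i with
  | zero =>
    simp only [Nat.cast_zero, opow_zero] at *
    have := subsingleton_of_length_lt_one hN
    have := subsingleton_of_length_lt_one hQ
    have : Subsingleton M := subsingleton_of_forall_eq 0 fun x => by
      obtain ⟨n, rfl⟩ := (h x).1 (Subsingleton.elim _ _)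
      rw [Subsingleton.elim n 0, map_zero]
    rw [length_eq_zero_of_subsingleton]
    exact zero_lt_one
  | succ e =>
    exact (length_le_of_exact (G := truncNatAdd e) h
      (fun _ _ _ hab hb => truncNatAdd_strictMono_left hab (hb.trans_lt hN))
      (fun _ _ _ hab _ => truncNatAdd_strictMono_right hab)).trans_lt (truncNatAdd_lt hQ hN)

theorem length_le_add_of_exact {f : N →ₗ[R] M} {g : M →ₗ[R] Q}
    (h : Function.Exact f g) {e : ℕ} (hN : length R N < ω ^ ((e + 1 : ℕ) : Ordinal.{v}))
    (hQ : ω ^ (e : Ordinal.{v}) ∣ length R Q) : length R M ≤ length R Q + length R N := by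
  obtain ⟨γ, hγ⟩ := hQ
  refine (length_le_of_exact (G := truncNatAdd e) h
      (fun _ _ _ hab hb => truncNatAdd_strictMono_left hab (hb.trans_lt hN))
      (fun _ _ _ hab _ => truncNatAdd_strictMono_right hab)).trans_eq ?_
  rw [hγ, truncNatAdd_mul hN]

/-- In the domain R/p, `K` contains all multiples of some nonzero x, and killing x lowers the
dimension. -/
theorem supportDim_quotient_succ_le_of_equiv (p : PrimeSpectrum R) (φ : N ≃ₗ[R] R ⧸ p.1)
    {K : Submodule R N} (hK : K ≠ ⊥) :
    Module.supportDim R (N ⧸ K) + 1 ≤ Module.supportDim R N := by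
  obtain ⟨n, hn, hn0⟩ := K.exists_mem_ne_zero_of_ne_bot hK
  obtain ⟨x, hx⟩ := Ideal.Quotient.mk_surjective (φ n)
  have hxp : x ∉ p.1 := fun h => hn0 <| by
    rw [← φ.map_eq_zero_iff, ← hx, Ideal.Quotient.eq_zero_iff_mem]
    exact h
  have hle : x • (⊤ : Submodule R N) ≤ K := by
    rintro _ ⟨y, -, rfl⟩
    obtain ⟨r, hr⟩ := Ideal.Quotient.mk_surjective (φ y)
    have : x • y = r • n := φ.injective <| by
      rw [map_smul, map_smul, ← hx, ← hr, Algebra.smul_def, Algebra.smul_def]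
      exact mul_comm _ _
    change x • y ∈ K
    rw [this]
    exact K.smul_mem r hn
  refine le_trans (add_le_add_left (Module.supportDim_le_of_surjective
    (Submodule.factor hle) (Submodule.factor_surjective hle)) 1) ?_
  have : Module.Finite R N := Module.Finite.equiv φ.symm
  refine Module.supportDim_quotSMulTop_succ_le_of_notMem_minimalPrimes fun q hq hxq => hxp ?_
  rw [φ.annihilator_eq, Ideal.annihilator_quotient, Ideal.minimalPrimes_eq_subsingleton_self] at hq
  rwa [← Set.mem_singleton_iff.1 hq]

theorem length_lt_opow_of_supportDim_lt [IsNoetherianRing R] [Module.Finite R M] {i : ℕ}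
    (h : Module.supportDim R M < i) : length R M < ω ^ (i : Ordinal.{v}) := by
  induction i generalizing M with
  | zero =>
    have : Subsingleton M := by
      by_contra hM
      rw [not_subsingleton_iff_nontrivial] at hM
      have : Nonempty (Module.support R M) := Module.nonempty_support_of_nontrivial.to_subtype
      exact h.not_ge (by simpa using! Order.krullDim_nonneg)
    rw [length_eq_zero_of_subsingleton]
    exact omega0_opow_pos _
  | succ i ih =>
    revert h
    induction ‹Module.Finite R M› using
      IsNoetherianRing.induction_on_isQuotientEquivQuotientPrime R with
    | subsingleton N =>
      intro _
      rw [length_eq_zero_of_subsingleton]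
      exact omega0_opow_pos _
    | quotient N p φ =>
      intro h
      have hle : length R N ≤ ω ^ (i : Ordinal.{v}) := by
        refine length_le ?_
        rintro α ⟨c, hc⟩
        -- The term at index ω^i would be nonzero, so the quotient by it has dimension below `i`,
        -- yet it carries a chain of length ω^i.
        by_contra! hlt
        have hne : c (ω ^ (i : Ordinal.{v})) ≠ ⊥ :=
          (bot_le.trans_lt (hc hlt.le (le_refl α) hlt)).ne'
        have hdim := (supportDim_quotient_succ_le_of_equiv p φ hne).trans_lt h
        rw [Nat.cast_succ] at hdim
        refine (ih (lt_of_add_lt_add_right hdim)).not_ge (le_length ?_)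
        exact mem_chainLengths_quotient (hc.mono (Set.Iic_subset_Iic.2 hlt.le))
      refine hle.trans_lt ?_
      rw [opow_lt_opow_iff_right one_lt_omega0]
      exact_mod_cast Nat.lt_succ_self i
    | exact N₁ N₂ N₃ f g hf hg hfg h₁ h₃ =>
      intro h
      exact length_lt_opow_of_exact hfg
        (h₁ ((Module.supportDim_le_of_injective f hf).trans_lt h))
        (h₃ ((Module.supportDim_le_of_surjective g hg).trans_lt h))

/-- Inside `M` lies a cyclic C ≅ R/P with P below the first prime. An element a of the second prime
outside the first acts injectively on C, and the remaining primes start in the support of C/aC.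
Repeating its chain ω times raises the exponent by one. -/
theorem opow_mem_chainLengths_of_ltSeries [IsNoetherianRing R] [Module.Finite R M]
    (s : LTSeries (PrimeSpectrum R)) (hs : s.head ∈ Module.support R M) :
    (ω : Ordinal.{v}) ^ (s.length : Ordinal.{v}) ∈ chainLengths R M := by
  induction hi : s.length generalizing M s with
  | zero =>
    have : Nontrivial M := by
      by_contra hM
      rw [not_nontrivial_iff_subsingleton] at hM
      simp [Module.support_eq_empty] at hs
    simpa using one_mem_chainLengths
  | succ i ih =>
    obtain ⟨P, hPm, hP⟩ := Ideal.exists_minimalPrimes_le (Module.mem_support_iff_of_finite.1 hs)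
    have hass := Module.associatedPrimes.minimalPrimes_annihilator_subset_associatedPrimes R M hPm
    rw [AssociatedPrimes.mem_iff, isAssociatedPrime_iff] at hass
    obtain ⟨hPp, x, hx⟩ := hass
    have hPx : ∀ r, r ∈ P ↔ r • x = 0 := fun r => by simp [hx, Submodule.mem_colon_singleton]
    have hs0 : s.length ≠ 0 := by omega
    have hlt : s.head < (s.tail hs0).head := by
      rw [RelSeries.head_tail]
      exact s.strictMono (by simp [Fin.lt_def, hi])
    obtain ⟨a, haq, hap⟩ := SetLike.exists_of_lt (show s.head.1 < (s.tail hs0).head.1 from hlt)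
    have haP : a ∉ P := fun h => hap (hP h)
    let C := Submodule.span R {x}
    let φ : C →ₗ[R] C := DistribSMul.toLinearMap R C a
    have hφ : Function.Injective φ := by
      rw [injective_iff_map_eq_zero]
      rintro ⟨y, hy⟩ h
      obtain ⟨r, rfl⟩ := Submodule.mem_span_singleton.1 hy
      have h' : a • r • x = 0 := congrArg Subtype.val h
      rw [smul_smul, ← hPx] at h'
      exact Subtype.ext ((hPx r).1 ((hPp.mem_or_mem h').resolve_left haP))
    have hx0 : x ≠ 0 := fun h => hPp.ne_top ((Ideal.eq_top_iff_one _).2 ((hPx 1).2 (by simp [h])))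
    have : Nontrivial C := ⟨⟨⟨x, Submodule.mem_span_singleton_self x⟩, 0,
      fun h => hx0 (congrArg Subtype.val h)⟩⟩
    have hrange : LinearMap.range φ = a • (⊤ : Submodule R C) := LinearMap.range_eq_map φ
    have hC : (s.tail hs0).head ∈ Module.support R C := by
      rw [Module.mem_support_iff_of_finite]
      intro r hr
      refine hlt.le (hP ((hPx r).2 ?_))
      exact congrArg Subtype.val
        (Module.mem_annihilator.1 hr ⟨x, Submodule.mem_span_singleton_self x⟩)
    have hsupp : (s.tail hs0).head ∈ Module.support R (C ⧸ LinearMap.range φ) := by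
      rw [hrange]
      change _ ∈ Module.support R (QuotSMulTop a C)
      rw [Module.support_quotSMulTop]
      exact ⟨hC, by simpa using haq⟩
    have := mul_omega0_mem_chainLengths hφ (omega0_opow_pos _)
      (ih (s.tail hs0) hsupp (by simp [hi]))
    rw [← omega0_opow_natCast_succ] at this
    exact chainLengths_subset_of_injective C.subtype C.subtype_injective this

theorem opow_mem_chainLengths_of_le_supportDim [IsNoetherianRing R] [Module.Finite R M] {i : ℕ}
    (h : i ≤ Module.supportDim R M) : (ω : Ordinal.{v}) ^ (i : Ordinal.{v}) ∈ chainLengths R M := by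
  obtain ⟨s, rfl⟩ := Order.le_krullDim_iff.1 h
  exact opow_mem_chainLengths_of_ltSeries (s.map Subtype.val fun _ _ h => h) s.head.2

theorem opow_mem_chainLengths_of_le_length [IsNoetherianRing R] [Module.Finite R M] {i : ℕ}
    (h : ω ^ (i : Ordinal.{v}) ≤ length R M) :
    (ω : Ordinal.{v}) ^ (i : Ordinal.{v}) ∈ chainLengths R M := by
  refine opow_mem_chainLengths_of_le_supportDim ?_
  by_contra! hlt
  exact h.not_gt (length_lt_opow_of_supportDim_lt hlt)

end Dimension

/-! ### Attained lengths, short submodules and rank-nullity -/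

section RankNullity

variable {R : Type u} [CommRing R] [IsNoetherianRing R] {M : Type v} [AddCommGroup M] [Module R M]
  [Module.Finite R M]

theorem exists_largest_of_length_lt (R : Type u) [CommRing R] [IsNoetherianRing R] (M : Type v)
    [AddCommGroup M] [Module R M] [Module.Finite R M] (i : ℕ) :
    ∃ D : Submodule R M, length R D < ω ^ (i : Ordinal.{v}) ∧
      ∀ N : Submodule R M, length R N < ω ^ (i : Ordinal.{v}) → N ≤ D := by
  obtain ⟨D, hD⟩ := exists_maximal_of_wellFoundedGT
    (fun N : Submodule R M => length R N < ω ^ (i : Ordinal.{v})) ⟨⊥, by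
      rw [length_eq_zero_of_subsingleton]
      exact omega0_opow_pos _⟩
  -- A sum of two short submodules is short, being a quotient of their product, so a maximal one is
  -- largest.
  refine ⟨D, hD.prop, fun N hN => le_sup_right.trans (hD.le_of_ge ?_ le_sup_left)⟩
  rw [Submodule.sup_eq_range]
  exact (length_le_of_surjective _ (LinearMap.surjective_rangeRestrict _)).trans_lt
    (length_lt_opow_of_exact (M := D × N) Function.Exact.inl_snd hD.prop hN)

/-- The length is attained by a chain. -/
theorem length_mem_chainLengths {n : ℕ} (hn : length R M < ω ^ (n : Ordinal.{v})) :
    length R M ∈ chainLengths R M := by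
  by_cases h0 : length R M = 0
  · rw [h0]
    exact zero_mem_chainLengths
  obtain ⟨i, δ, hδ⟩ := exists_eq_mul_add_opow h0 hn
  obtain ⟨D, hD, hDmax⟩ := exists_largest_of_length_lt R M i
  by_cases hex : ∃ c : Ordinal.{v} → Submodule R M, StrictAntiOn c (Set.Iic δ) ∧
      ω ^ (i : Ordinal.{v}) ≤ length R (c δ)
  · obtain ⟨c, hc, hcl⟩ := hex
    rw [hδ]
    exact add_mem_chainLengths (c δ).subtype_injective (c δ).mkQ_surjective
      (LinearMap.exact_subtype_mkQ (c δ)) (mem_chainLengths_quotient hc)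
      (opow_mem_chainLengths_of_le_length hcl)
  -- Otherwise every chain lies in `D` from index `δ` on, which bounds the length by δ + ℓ(D) < δ +
  -- ω^i.
  · push Not at hex
    refine absurd (length_le (R := R) (M := M) (α := δ + length R D) ?_) (not_le.2 ?_)
    · rintro α ⟨c, hc⟩
      rcases le_total α δ with h | h
      · exact h.trans le_self_add
      · rw [← Ordinal.add_sub_cancel_of_le h] at hc ⊢
        have hcD : c δ ≤ D := hDmax _ (hex c (hc.mono (Set.Iic_subset_Iic.2 le_self_add)))
        refine add_le_add_right (le_length (mem_chainLengths_of_forall_le (strictAntiOn_add hc)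
          fun β hβ => le_trans ?_ hcD)) δ
        exact hc.antitoneOn (Set.mem_Iic.2 le_self_add) (add_le_add_right hβ δ) le_self_add
    · conv_rhs => rw [hδ]
      exact add_lt_add_right hD δ

/-- A module all of whose nonzero submodules are long has length divisible by `ω ^ e`. -/
theorem opow_dvd_length {n : ℕ} (hn : length R M < ω ^ (n : Ordinal.{v})) {e : ℕ}
    (h : ∀ N : Submodule R M, N ≠ ⊥ → ω ^ (e : Ordinal.{v}) ≤ length R N) :
    ω ^ (e : Ordinal.{v}) ∣ length R M := by
  rw [dvd_iff_mod_eq_zero]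
  by_contra hρ
  have hdm := div_add_mod (length R M) (ω ^ (e : Ordinal.{v}))
  have hlt := mod_lt (length R M) (omega0_opow_pos (e : Ordinal.{v})).ne'
  set δ := ω ^ (e : Ordinal.{v}) * (length R M / ω ^ (e : Ordinal.{v}))
  have hδ : δ < length R M := by
    conv_rhs => rw [← hdm]
    exact lt_add_of_pos_right δ (pos_iff_ne_zero.2 hρ)
  obtain ⟨c, hc⟩ := length_mem_chainLengths hn
  have hcδ : c δ ≠ ⊥ := (bot_le.trans_lt (hc hδ.le (le_refl (length R M)) hδ)).ne'
  -- Replacing the tail of length less than ω^e after `δ` by one of length ω^e gives a chain longer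
  -- than ℓ(M).
  have hmem := add_mem_chainLengths (c δ).subtype_injective (c δ).mkQ_surjective
    (LinearMap.exact_subtype_mkQ (c δ))
    (mem_chainLengths_quotient (hc.mono (Set.Iic_subset_Iic.2 hδ.le)))
    (opow_mem_chainLengths_of_le_length (h _ hcδ))
  refine (le_length hmem).not_gt ?_
  conv_lhs => rw [← hdm]
  exact add_lt_add_right hlt δ

theorem length_add_length_le_of_exact {N Q : Type v} [AddCommGroup N] [Module R N]
    [AddCommGroup Q] [Module R Q]
    {n : ℕ} (hn : length R M < ω ^ (n : Ordinal.{v})) {f : N →ₗ[R] M} {g : M →ₗ[R] Q}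
    (hf : Function.Injective f) (hg : Function.Surjective g) (h : Function.Exact f g) :
    length R Q + length R N ≤ length R M :=
  have : Module.Finite R Q := Module.Finite.of_surjective g hg
  have : Module.Finite R N := Module.Finite.of_injective f hf
  le_length (add_mem_chainLengths hf hg h
    (length_mem_chainLengths ((length_le_of_surjective g hg).trans_lt hn))
    (length_mem_chainLengths ((length_le_of_injective f hf).trans_lt hn)))

/-- With D the largest submodule shorter than ω^e, M/D has no nonzero short submodule. Hence ω^e
divides ℓ(M/D), and ℓ(M) = ℓ(M/D) + ℓ(D) forces ℓ(D) = 0. -/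
theorem eq_bot_of_length_lt {n : ℕ} (hn : length R M < ω ^ (n : Ordinal.{v})) {e : ℕ}
    (h : ω ^ (e : Ordinal.{v}) ∣ length R M) {N : Submodule R M}
    (hN : length R N < ω ^ (e : Ordinal.{v})) : N = ⊥ := by
  obtain ⟨D, hD, hDmax⟩ := exists_largest_of_length_lt R M e
  have hQ : ω ^ (e : Ordinal.{v}) ∣ length R (M ⧸ D) := by
    refine opow_dvd_length ((length_le_of_surjective _ D.mkQ_surjective).trans_lt hn)
      fun K hK => ?_
    by_contra! hlt
    refine hK ?_
    let g : K.comap D.mkQ →ₗ[R] K := D.mkQ.restrict fun x hx => hx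
    let f : D →ₗ[R] K.comap D.mkQ := Submodule.inclusion (D.le_comap_mkQ K)
    have hfg : Function.Exact f g := by
      rintro ⟨x, hx⟩
      constructor
      · intro h0
        have hxD : x ∈ D := by
          rw [← Submodule.Quotient.mk_eq_zero]
          exact congrArg Subtype.val h0
        exact ⟨⟨x, hxD⟩, rfl⟩
      · rintro ⟨y, hy⟩
        rw [← hy]
        exact Subtype.ext ((Submodule.Quotient.mk_eq_zero D).2 y.2)
    have hle := hDmax _ (length_lt_opow_of_exact hfg hD hlt)
    rw [eq_bot_iff]
    intro y hy
    obtain ⟨x, rfl⟩ := D.mkQ_surjective y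
    exact (Submodule.Quotient.mk_eq_zero D).2 (hle hy)
  have hDe : length R D < ω ^ ((e + 1 : ℕ) : Ordinal.{v}) := hD.trans_le
    (opow_le_opow_right omega0_pos (by exact_mod_cast Nat.le_succ e))
  have heq : length R M = length R (M ⧸ D) + length R D :=
    (length_le_add_of_exact (LinearMap.exact_subtype_mkQ D) hDe hQ).antisymm
      (length_add_length_le_of_exact hn D.subtype_injective D.mkQ_surjective
        (LinearMap.exact_subtype_mkQ D))
  rw [heq, dvd_add_iff hQ] at h
  have h0 : length R D = 0 := by
    by_contra h0
    exact (le_of_dvd h0 h).not_gt hD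
  have : Subsingleton D := subsingleton_of_length_lt_one (by rw [h0]; exact zero_lt_one)
  exact le_bot_iff.1 ((hDmax N hN).trans_eq (Submodule.subsingleton_iff_eq_bot.1 this))

theorem satisfiesRankNullity_of_opow_dvd {n : ℕ} (hn : length R M < ω ^ (n : Ordinal.{v})) {e : ℕ}
    (h : ω ^ (e : Ordinal.{v}) ∣ length R M) {f : Module.End R M}
    (hf : Module.supportDim R (LinearMap.ker f) ≤ e) : SatisfiesRankNullity f := by
  have hK : length R (LinearMap.ker f) < ω ^ ((e + 1 : ℕ) : Ordinal.{v}) :=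
    length_lt_opow_of_supportDim_lt (hf.trans_lt (by exact_mod_cast Nat.lt_succ_self e))
  have hI : ω ^ (e : Ordinal.{v}) ∣ length R (LinearMap.range f) := by
    refine opow_dvd_length
      ((length_le_of_injective _ (LinearMap.range f).subtype_injective).trans_lt hn)
      fun N hN => ?_
    by_contra! hlt
    have hinj := (LinearMap.range f).subtype_injective
    rw [length_eq_of_equiv (Submodule.equivMapOfInjective _ hinj N)] at hlt
    exact hN (((Submodule.map_injective_of_injective hinj).eq_iff' (Submodule.map_bot _)).1 (eq_bot_of_length_lt hn h hlt))
  have hexact : Function.Exact (LinearMap.ker f).subtype f.rangeRestrict := by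
    rw [LinearMap.exact_iff, LinearMap.ker_rangeRestrict, Submodule.range_subtype]
  rw [SatisfiesRankNullity, shuffleSum_eq_add hK hI]
  exact (length_le_add_of_exact hexact hK hI).antisymm
    (length_add_length_le_of_exact hn (LinearMap.ker f).subtype_injective
      f.surjective_rangeRestrict hexact)

theorem satisfiesRankNullity_of_ker_eq_bot {R : Type u} [CommRing R] {M : Type v}
    [AddCommGroup M] [Module R M] {f : Module.End R M} (hf : LinearMap.ker f = ⊥) :
    SatisfiesRankNullity f := by
  have : Subsingleton (LinearMap.ker f) := Submodule.subsingleton_iff_eq_bot.2 hf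
  rw [SatisfiesRankNullity, length_eq_zero_of_subsingleton (M := LinearMap.ker f), shuffleSum,
    CNF.coeff_zero_right, zero_add, CNF.eval_coeff]
  exact length_eq_of_equiv (LinearEquiv.ofInjective f (LinearMap.ker_eq_bot.1 hf))

/-- An associated prime p of `N` is one of `M`, and R/p embeds in `N`. -/
theorem IsUnmixed.supportDim_le {R : Type u} [CommRing R] [IsNoetherianRing R] {M : Type v}
    [AddCommGroup M] [Module R M] (h : IsUnmixed R M) {N : Submodule R M} (hN : N ≠ ⊥) :
    Module.supportDim R M ≤ Module.supportDim R N := by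
  have : Nontrivial N := (Submodule.nontrivial_iff_ne_bot).2 hN
  obtain ⟨p, hp⟩ := associatedPrimes.nonempty R N
  rw [← h p (associatedPrimes.subset_of_injective N.subtype_injective hp),
    ← Module.supportDim_quotient_eq_ringKrullDim]
  obtain ⟨-, f, hf⟩ := (isAssociatedPrime_iff_exists_injective_linearMap p N).1 hp
  exact Module.supportDim_le_of_injective f hf

end RankNullity

end OrdLen

theorem theoremT (R : Type u) [CommRing R] [IsNoetherianRing R]
    (hR : ringKrullDim R < ⊤) (M : Type v) [AddCommGroup M] [Module R M] [Module.Finite R M] :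
    (∀ f : Module.End R M, OrdLen.IsLow (LinearMap.ker f) → OrdLen.SatisfiesRankNullity f) ∧
    (OrdLen.IsUnmixed R M → ∀ f : Module.End R M, OrdLen.SatisfiesRankNullity f) := by
  by_cases hM : Module.supportDim R M = ⊥
  · have := (Module.supportDim_eq_bot_iff_subsingleton R M).1 hM
    have (f : Module.End R M) : OrdLen.SatisfiesRankNullity f :=
      OrdLen.satisfiesRankNullity_of_ker_eq_bot (Subsingleton.elim _ _)
    exact ⟨fun f _ => this f, fun _ f => this f⟩
  obtain ⟨d, hd⟩ : ∃ d : ℕ, Module.supportDim R M = d := by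
    have hlt := (Module.supportDim_le_ringKrullDim R M).trans_lt hR
    obtain ⟨d, hd⟩ := WithBot.ne_bot_iff_exists.1 hM
    rw [← hd] at hlt ⊢
    obtain ⟨k, rfl⟩ := ENat.ne_top_iff_exists.1 (WithBot.coe_lt_coe.1 hlt).ne
    exact ⟨k, rfl⟩
  have hn : OrdLen.length R M < Ordinal.omega0 ^ ((d + 1 : ℕ) : Ordinal.{v}) :=
    OrdLen.length_lt_opow_of_supportDim_lt (hd.trans_lt (by exact_mod_cast Nat.lt_succ_self d))
  refine ⟨?_, fun h f => ?_⟩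
  · rintro f ⟨e, he, hf⟩
    exact OrdLen.satisfiesRankNullity_of_opow_dvd hn he.opow_dvd_length hf.le
  · refine OrdLen.satisfiesRankNullity_of_opow_dvd hn (OrdLen.opow_dvd_length hn fun N hN => ?_)
      ((Module.supportDim_le_of_injective _ (LinearMap.ker f).subtype_injective).trans_eq hd)
    exact OrdLen.le_length
      (OrdLen.opow_mem_chainLengths_of_le_supportDim (hd.symm.trans_le (h.supportDim_le hN)))
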